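/- Let $\mathcal M$ be a Markov automaton with finite state space $S$, a finite set $A$ of actions (all internal), probabilistic transitions $s \xrightarrow{\alpha} \mu$ with $\mu$ a probability distribution on $S$, where $\alpha$ and $s$ determine $\mu=\mu^s_\alpha$, and Markovian transitions from $s$ to $s'$ with rates $\lambda>0$. Let $\mathbf R(s,s')<\infty$ be the sum of the rates of all Markovian transitions from $s$ to $s'$, and $E(s)=\sum_{s'}\mathbf R(s,s')$. Let $PS$ be the set of states with a probabilistic transition, and $MS$ the set of states with a Markovian transition and no probabilistic one (by maximal progress, Markovian transitions of states in $PS$ are never taken). Assume that $S=PS\cup MS$, that $\mathcal M$ is non-Zeno, i.e. there is no cycle consisting solely of probabilistic transitions (taken with positive probability), and that $G\subseteq S$ consists of absorbing states in $MS$ (their only Markovian transitions are self-loops). For a policy $D$ (measurable, randomised, depending on the whole timed history, choosing among the actions enabled in the current state), let $\mathbb E_{s,D}(V_G)\in[0,\infty]$ be the expected elapsed time before first visiting $G$ from $s$ ($V_G=\infty$ on paths that never visit $G$); a state in $MS$ is left after an exponentially distributed time with rate $E(s)$, with probability $\mathbf R(s,s')/E(s)$ to $s'$, and a state in $PS$ is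 left after time $0$ via the chosen action $\alpha$ according to $\mu^s_\alpha$. Let $eT^{\min}(s,\Diamond G)=\inf_D\mathbb E_{s,D}(V_G)$. Let $\mathsf{ssp}_{et}(\mathcal M)$ be the stochastic shortest path problem with states $S$, actions $A\cup\{\bot\}$, goal set $G$, zero terminal cost, transition probabilities $\mathbf P(s,\bot,s')=\mathbf R(s,s')/E(s)$ for $s\in MS$, $\mathbf P(s,\alpha,s')=\mu^s_\alpha(s')$ if $s\xrightarrow{\alpha}\mu^s_\alpha$, and $\mathbf P=0$ otherwise, and costs $c(s,\bot)=1/E(s)$ for $s\in MS\setminus G$ and $c=0$ otherwise. Let $cR^{\min}(s,\Diamond G)$ be the infimum over all (randomised, history-dependent) policies of the expected cost accumulated from $s$ until $G$ is reached ($\infty$ on paths that never reach $G$). Then: 1. $eT^{\min}(s,\Diamond G)=cR^{\min}(s,\Diamond G)$ for every $s\in S$. 2. There is a stationary deterministic policy $D$ on $\mathcal M$ (given by a map $PS\to A$) with $\mathbb E_{s,D}(V_G)=eT^{\min}(s,\Diamond G)$ for every $s\in S$. 3. The function $eT^{\min}(\cdot,\Diamond G)$ is a fixpoint of the Bellman operator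 $L$ given by $$[L(v)](s)=\begin{cases}\frac1{E(s)}+\sum_{s'}\frac{\mathbf R(s,s')}{E(s)}\,v(s') & s\in MS\setminus G,\\ \min_{\alpha:\,s\xrightarrow{\alpha}\mu^s_\alpha}\sum_{s'}\mu^s_\alpha(s')\,v(s') & s\in PS\setminus G,\\ 0 & s\in G\end{cases}$$ (with $0\cdot\infty=0$), and it is the only fixpoint among the functions $v:S\to(-\infty,\infty]$ that are finite at every state where $eT^{\min}(\cdot,\Diamond G)$ is finite. In particular every real-valued fixpoint of $L$ equals $eT^{\min}(\cdot,\Diamond G)$. -/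

import Mathlib

open MeasureTheory ProbabilityTheory
open scoped ENNReal NNReal

noncomputable section

/-! ### Probability measures on infinite paths induced by policies

The following is shared by Markov automata and by Markov decision processes.  A path is a sequence
of records `x 0, x 1, x 2, …`, each of type `X`; the record `x (n + 1)` holds what happened in the
`(n + 1)`-st step (the chosen label, possibly the elapsed time, and the state that is entered). -/

/-- Finite paths with `n` steps. -/
abbrev FinPath (X : Type*) (n : ℕ) : Type _ := (_ : Finset.Iic n) → X

/-- The last record of a finite path. -/
def FinPath.last {X : Type*} {n : ℕ} (h : FinPath X n) : X := h ⟨n, Finset.mem_Iic.2 le_rfl⟩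

/-- A controlled process: `enabled x l` says that the label `l` can be chosen after a finite path
with last record `x`, and then `law x l` is the distribution of the next record. -/
structure ControlledProcess (X L : Type*) [MeasurableSpace X] where
  enabled : X → L → Prop
  law : X → L → Measure X
  measurable_law : ∀ l, Measurable fun x => law x l
  isProb_law : ∀ x l, enabled x l → IsProbabilityMeasure (law x l)

/-- A policy: a measurable function which yields for each finite path a probability distribution
over the set of enabled labels. -/
structure ControlledProcess.Policy {X L : Type*} [MeasurableSpace X] (C : ControlledProcess X L) where
  choice : (n : ℕ) → FinPath X n → PMF L
  measurable_choice : ∀ n l, Measurable fun h => choice n h l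
  enabled_of_choice : ∀ n h l, choice n h l ≠ 0 → C.enabled h.last l

section PathMeasure

variable {X L : Type*} [MeasurableSpace X] [Fintype L] {C : ControlledProcess X L}

/-- The distribution of the next record, given the finite path so far: choose a label with the
policy, then follow the law of that label. -/
def ControlledProcess.Policy.step (D : C.Policy) (n : ℕ) : Kernel (FinPath X n) X where
  toFun h := ∑ l, D.choice n h l • C.law h.last l
  measurable' := by
    refine Measure.measurable_of_measurable_coe _ fun B hB => ?_
    simp only [Measure.coe_finsetSum, Finset.sum_apply, Measure.smul_apply, smul_eq_mul]
    refine Finset.measurable_sum _ fun l _ => (D.measurable_choice n l).mul ?_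
    have h1 : Measurable fun h : FinPath X n => C.law h.last l :=
      (C.measurable_law l).comp (measurable_pi_apply _)
    exact (Measure.measurable_coe hB).comp h1

instance (D : C.Policy) (n : ℕ) : IsMarkovKernel (D.step n) where
  isProbabilityMeasure h := ⟨by
    have hstep : ∀ l, D.choice n h l * C.law h.last l Set.univ = D.choice n h l := by
      intro l
      by_cases hl : D.choice n h l = 0
      · simp [hl]
      · have := C.isProb_law _ _ (D.enabled_of_choice n h l hl)
        simp
    have hsum := (D.choice n h).tsum_coe
    rw [tsum_fintype] at hsum
    simpa [ControlledProcess.Policy.step, hstep] using hsum⟩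

/-- The probability measure on infinite paths under the policy `D`, for paths that start with the
record `x` (Ionescu-Tulcea). -/
def ControlledProcess.Policy.pathMeasure (D : C.Policy) (x : X) : Measure (ℕ → X) :=
  Kernel.traj (X := fun _ => X) (fun n => D.step n) 0 (fun _ => x)

end PathMeasure

/-! ### Stochastic shortest path problems

The label set is always `Option A`: `some α` is the action `α` and `none` is the label `⊥`. -/

instance instMeasurableSpaceOption (A : Type*) : MeasurableSpace (Option A) := ⊤

instance instDiscreteMeasurableSpaceOption (A : Type*) : DiscreteMeasurableSpace (Option A) :=
  ⟨fun _ => trivial⟩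

/-- A non-negative stochastic shortest path problem: an MDP with goal states, a cost function
(which is used only at non-goal states) and a terminal cost function (which is used only at goal
states).  A row `P s σ` that vanishes means that `σ` is not enabled in `s`. -/
structure SSP (S A : Type*) [Fintype S] where
  P : S → Option A → S → ℝ≥0∞
  sum_P : ∀ s σ, (∑ s', P s σ s' = 1) ∨ ∀ s', P s σ s' = 0
  init : S
  goal : Set S
  cost : S → Option A → ℝ≥0
  termCost : S → ℝ≥0

namespace SSP

variable {S A : Type*} [Fintype S] [MeasurableSpace S] [DiscreteMeasurableSpace S]

/-- In a path `x` of an MDP, `(x 0).2` is the first state, and `x (n + 1) = (σₙ, sₙ₊₁)`.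
The label of `x 0` is a dummy. -/
def controlled (N : SSP S A) : ControlledProcess (Option A × S) (Option A) where
  enabled x σ := ∑ s', N.P x.2 σ s' = 1
  law x σ := ∑ s', N.P x.2 σ s' • Measure.dirac (σ, s')
  measurable_law σ :=
    (measurable_of_countable fun s => ∑ s', N.P s σ s' • Measure.dirac (σ, s')).comp measurable_snd
  isProb_law x σ h := ⟨by simpa using h⟩

open Classical in
/-- The accumulated cost along a path before reaching the goal states: `∑_{j<k} c(sⱼ,σⱼ) + g(sₖ)`
where `k` is the first index at which the path is in a goal state; `∞` if there is none. -/
def accCost (N : SSP S A) (x : ℕ → Option A × S) : ℝ≥0∞ :=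
  if h : ∃ k, (x k).2 ∈ N.goal then
    ∑ j ∈ Finset.range (Nat.find h), (N.cost (x j).2 (x (j + 1)).1 : ℝ≥0∞)
      + (N.termCost (x (Nat.find h)).2 : ℝ≥0∞)
  else ⊤

variable [Fintype A]

/-- The minimal expected accumulated cost to reach the goal states from `s`. -/
def minExpectedCost (N : SSP S A) (s : S) : ℝ≥0∞ :=
  ⨅ D : N.controlled.Policy, ∫⁻ x, N.accCost x ∂(D.pathMeasure (none, s))

end SSP

/-! ### Markov automata -/

/-- A Markov automaton with states `S` and actions `A`, all of which are internal.
`prob s α = some μ` is the probabilistic transition `s —α→ μ`; thus an action `α` that is enabled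
in `s` determines its distribution.  `(s, r, s') ∈ markov` is the Markovian transition from `s` to
`s'` with rate `r`; total rates are finite. -/
structure MarkovAutomaton (S A : Type*) where
  prob : S → A → Option (PMF S)
  markov : Set (S × ℝ≥0 × S)
  rate_pos : ∀ s r s', (s, r, s') ∈ markov → 0 < r
  summable_rate : ∀ s s', Summable fun r : {r : ℝ≥0 // (s, r, s') ∈ markov} => (r : ℝ≥0)
  init : S

namespace MarkovAutomaton

variable {S A : Type*}

/-- Probabilistic states. -/
def PS (M : MarkovAutomaton S A) : Set S := {s | ∃ α μ, M.prob s α = some μ}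

/-- Markovian states.  By maximal progress, Markovian transitions of a state that has a
probabilistic transition are never taken. -/
def MS (M : MarkovAutomaton S A) : Set S := {s | s ∉ M.PS ∧ ∃ r s', (s, r, s') ∈ M.markov}

/-- The total rate `R(s, s')` to move from `s` to `s'`. -/
def rate (M : MarkovAutomaton S A) (s s' : S) : ℝ≥0 :=
  ∑' r : {r : ℝ≥0 // (s, r, s') ∈ M.markov}, (r : ℝ≥0)

/-- There is a probabilistic transition from `s` that leads to `s'` with positive probability. -/
def ProbEdge (M : MarkovAutomaton S A) (s s' : S) : Prop := ∃ α μ, M.prob s α = some μ ∧ μ s' ≠ 0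

/-- There is no cycle that consists solely of probabilistic transitions. -/
def NonZeno (M : MarkovAutomaton S A) : Prop := ∀ s, ¬ Relation.TransGen M.ProbEdge s s

/-- All states in `G` are absorbing Markovian states. -/
def Absorbing (M : MarkovAutomaton S A) (G : Set S) : Prop :=
  ∀ s ∈ G, s ∈ M.MS ∧ ∀ r s', (s, r, s') ∈ M.markov → s' = s

variable [Fintype S]

/-- The exit rate `E(s)`. -/
def exitRate (M : MarkovAutomaton S A) (s : S) : ℝ≥0 := ∑ s', M.rate s s'

open Classical in
/-- The transition probabilities `P(s, σ, s')`. -/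
def P (M : MarkovAutomaton S A) (s : S) : Option A → S → ℝ≥0∞
  | none, s' => if s ∈ M.MS then ((M.rate s s' / M.exitRate s : ℝ≥0) : ℝ≥0∞) else 0
  | some α, s' => match M.prob s α with
    | some μ => μ s'
    | none => 0

/-- The label `σ` is enabled in `s`: `⊥` in a Markovian state, and the actions of the probabilistic
transitions of `s` otherwise. -/
def Enabled (M : MarkovAutomaton S A) (s : S) : Option A → Prop
  | none => s ∈ M.MS
  | some α => ∃ μ, M.prob s α = some μ

lemma exitRate_pos (M : MarkovAutomaton S A) {s : S} (hs : s ∈ M.MS) : 0 < M.exitRate s := by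
  obtain ⟨-, r, s', h⟩ := hs
  have h1 : r ≤ M.rate s s' := (M.summable_rate s s').le_tsum ⟨r, h⟩ fun _ _ => zero_le
  exact (M.rate_pos _ _ _ h).trans_le
    (h1.trans (Finset.single_le_sum (fun _ _ => zero_le) (Finset.mem_univ s')))

lemma sum_P (M : MarkovAutomaton S A) (s : S) (σ : Option A) :
    M.Enabled s σ ∧ (∑ s', M.P s σ s' = 1) ∨ ∀ s', M.P s σ s' = 0 := by
  cases σ with
  | none =>
    by_cases hs : s ∈ M.MS
    · refine Or.inl ⟨hs, ?_⟩
      have h0 := (M.exitRate_pos hs).ne'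
      have h1 : ∑ s', M.rate s s' / M.exitRate s = 1 := by
        rw [← Finset.sum_div]; exact div_self h0
      simp only [P, hs, if_true]
      exact_mod_cast h1
    · exact Or.inr fun s' => by simp [P, hs]
  | some α =>
    cases h : M.prob s α with
    | none => exact Or.inr fun s' => by simp [P, h]
    | some μ =>
      refine Or.inl ⟨⟨μ, h⟩, ?_⟩
      have := μ.tsum_coe
      rw [tsum_fintype] at this
      simpa [P, h] using this

lemma sum_P_of_enabled (M : MarkovAutomaton S A) {s : S} {σ : Option A} (h : M.Enabled s σ) :
    ∑ s', M.P s σ s' = 1 := by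
  cases σ with
  | none =>
    have hs : s ∈ M.MS := h
    have h0 := (M.exitRate_pos hs).ne'
    have h1 : ∑ s', M.rate s s' / M.exitRate s = 1 := by
      rw [← Finset.sum_div]; exact div_self h0
    simp only [P, hs, if_true]
    exact_mod_cast h1
  | some α =>
    obtain ⟨μ, hμ⟩ := h
    have := μ.tsum_coe
    rw [tsum_fintype] at this
    simpa [P, hμ] using this

open Classical in
/-- The stochastic shortest path problem of a Markov automaton for the expected time reachability
of `G`. -/
def sspEt (M : MarkovAutomaton S A) (G : Set S) : SSP S A where
  P := M.P
  sum_P s σ := (M.sum_P s σ).imp_left And.right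
  init := M.init
  goal := G
  cost s σ := if s ∈ M.MS \ G ∧ σ = none then 1 / M.exitRate s else 0
  termCost _ := 0

/-- The distribution of the sojourn time in `s` if `s` is left with the label `σ`: exponential with
rate `E(s)` for `⊥`, and zero for an action. -/
def sojourn (M : MarkovAutomaton S A) (s : S) : Option A → Measure ℝ≥0
  | none => (expMeasure (M.exitRate s)).map Real.toNNReal
  | some _ => Measure.dirac 0

lemma isProb_sojourn (M : MarkovAutomaton S A) {s : S} {σ : Option A} (h : M.Enabled s σ) :
    IsProbabilityMeasure (M.sojourn s σ) := by
  cases σ with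
  | none =>
    have := isProbabilityMeasure_expMeasure (NNReal.coe_pos.2 (M.exitRate_pos h))
    exact Measure.isProbabilityMeasure_map measurable_real_toNNReal.aemeasurable
  | some α => exact Measure.dirac.isProbabilityMeasure

variable [MeasurableSpace S] [DiscreteMeasurableSpace S]

/-- In a path `x` of a Markov automaton, `(x 0).2.2` is the first state, and
`x (n + 1) = (σₙ, tₙ, sₙ₊₁)`: after residing `tₙ` time units in `sₙ`, the automaton moved to
`sₙ₊₁` with the label `σₙ`.  (The distribution `μₙ` is determined by `sₙ` and `σₙ`.)  The label and
the time of `x 0` are dummies. -/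
def controlled (M : MarkovAutomaton S A) : ControlledProcess (Option A × ℝ≥0 × S) (Option A) where
  enabled x σ := M.Enabled x.2.2 σ
  law x σ := ∑ s', M.P x.2.2 σ s' • (M.sojourn x.2.2 σ).map fun t => (σ, t, s')
  measurable_law σ :=
    (measurable_of_countable fun s =>
      ∑ s', M.P s σ s' • (M.sojourn s σ).map fun t => (σ, t, s')).comp
      (measurable_snd.comp measurable_snd)
  isProb_law x σ h := ⟨by
    have := M.isProb_sojourn h
    have h2 : ∀ s' : S, ((M.sojourn x.2.2 σ).map fun t => (σ, t, s')) Set.univ = 1 := by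
      intro s'
      rw [Measure.map_apply (by fun_prop) MeasurableSet.univ]
      simp
    simpa [h2] using M.sum_P_of_enabled h⟩

/-- The state `sₙ` of a path. -/
def state (x : ℕ → Option A × ℝ≥0 × S) (n : ℕ) : S := (x n).2.2

/-- The time at which the `n`-th state of a path is entered. -/
def entryTime (x : ℕ → Option A × ℝ≥0 × S) (n : ℕ) : ℝ≥0 :=
  ∑ i ∈ Finset.range n, (x (i + 1)).2.1

/-- The set of states that a path occupies at time `t`. -/
def occupied (x : ℕ → Option A × ℝ≥0 × S) (t : ℝ≥0) : Set S :=
  {s | ∃ n, state x n = s ∧ entryTime x n ≤ t ∧ t ≤ entryTime x (n + 1)}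

/-- The elapsed time before first visiting some state in `G`; `∞` if there is no such visit. -/
def timeTo (G : Set S) (x : ℕ → Option A × ℝ≥0 × S) : ℝ≥0∞ :=
  ⨅ (t : ℝ≥0) (_ : (G ∩ occupied x t).Nonempty), (t : ℝ≥0∞)

variable [Fintype A]

/-- The expected time to reach `G` from `s` under the policy `D`. -/
def expectedTime (M : MarkovAutomaton S A) (D : M.controlled.Policy) (G : Set S) (s : S) : ℝ≥0∞ :=
  ∫⁻ x, timeTo G x ∂(D.pathMeasure (none, 0, s))

/-- The minimal expected time to reach `G` from `s`, over all policies. -/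
def minExpectedTime (M : MarkovAutomaton S A) (G : Set S) (s : S) : ℝ≥0∞ :=
  ⨅ D : M.controlled.Policy, M.expectedTime D G s

/-- The policy `D` is stationary and deterministic: it is given by a mapping from the
probabilistic states to the actions.  (In a Markovian state only `⊥` is enabled.) -/
def IsStationaryDeterministic (M : MarkovAutomaton S A) (D : M.controlled.Policy) : Prop :=
  ∃ d : M.PS → A, ∀ (n : ℕ) (h : FinPath (Option A × ℝ≥0 × S) n) (hs : h.last.2.2 ∈ M.PS),
    D.choice n h = PMF.pure (some (d ⟨h.last.2.2, hs⟩))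

open Classical in
/-- The Bellman operator `L`.  (The infimum is over a finite set, which is nonempty if `s` is a
probabilistic state.) -/
def bellman (M : MarkovAutomaton S A) (G : Set S) (v : S → EReal) (s : S) : EReal :=
  if s ∈ G then 0
  else if s ∈ M.MS then
    ((1 / M.exitRate s : ℝ≥0) : ℝ≥0∞) + ∑ s', (M.P s none s' : EReal) * v s'
  else
    ⨅ (α : A) (μ : PMF S) (_ : M.prob s α = some μ), ∑ s', (μ s' : EReal) * v s'

end MarkovAutomaton

end

/-! An exponential sojourn with rate `E(s)` has mean `1/E(s)` and is independent of the successor.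
Hence, in terms of current state and expected cost per step, the automaton and its shortest path
problem are the same finite decision process. `CostModel` captures this common structure, and both
problems are shown to have the same optimum `value`, the limit of Bellman iteration from 0 and the
least fixpoint in `[0, ∞]`.

Lower bound: the n-th iterate bounds the expected cost of every history-dependent policy, by
induction on the horizon (`le_lintegral_totalCost`).

Upper bound: a stationary greedy policy accumulates at most `value` before reaching the goal. A path
that never reaches the goal must count as `∞`, however, so reachability with probability one is also
needed. Only probabilistic steps are free, and being non-Zeno bounds their runs: there is a bounded
potential for which every step costs at least a fixed `gap` plus the expected increase of the
potential (`gap_add_mean_potential_le`). Finite expected cost then forces almost sure reachability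
(`measure_never_eq_zero`).

Uniqueness: a minimum argument shows that a fixpoint avoiding `⊥` is non-negative
(`nonneg_of_fixed`), hence at least `value`. Conversely, `potential + value` is a weight for which
the greedy selector contracts the error, so the fixpoint is at most `value` (`le_value_of_fixed`).
-/

noncomputable section

set_option linter.unusedSectionVars false

namespace ControlledProcess

/-! ### One-step integration under a policy -/

section OneStep

variable {X L : Type*} [MeasurableSpace X] [Fintype L] {C : ControlledProcess X L}

instance (D : C.Policy) (x : X) : IsProbabilityMeasure (D.pathMeasure x) := by
  unfold Policy.pathMeasure; infer_instance

lemma Policy.lintegral_step (D : C.Policy) (n : ℕ) (h : FinPath X n) (f : X → ℝ≥0∞) :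
    ∫⁻ y, f y ∂(D.step n h) = ∑ l, D.choice n h l * ∫⁻ y, f y ∂(C.law h.last l) := by
  change ∫⁻ y, f y ∂(∑ l, D.choice n h l • C.law h.last l) = _
  simp [lintegral_finsetSum_measure]

/-- Tower property: the joint law of a prefix and the next record is the composition-product of the
prefix law with the kernel `step`. -/
lemma Policy.lintegral_pathMeasure_succ (D : C.Policy) (x : X) (n : ℕ)
    {f : FinPath X n × X → ℝ≥0∞} (hf : Measurable f) :
    ∫⁻ p, f (Preorder.frestrictLe n p, p (n + 1)) ∂D.pathMeasure x =
      ∫⁻ p, ∫⁻ y, f (Preorder.frestrictLe n p, y) ∂(D.step n (Preorder.frestrictLe n p))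
        ∂D.pathMeasure x := by
  have h := Kernel.partialTraj_compProd_eq_map_traj (X := fun _ => X) (κ := fun n => D.step n)
    (Nat.zero_le n) (x₀ := fun _ => x)
  have h2 := congrArg (fun μ => ∫⁻ q, f q ∂μ) h
  rw [lintegral_map hf (by fun_prop), Measure.lintegral_compProd hf,
    ← Kernel.traj_map_frestrictLe_apply, lintegral_map hf.lintegral_kernel_prod_right'
      (by fun_prop)] at h2
  exact h2.symm

lemma Policy.lintegral_pathMeasure_zero (D : C.Policy) (x : X) {f : X → ℝ≥0∞}
    (hf : Measurable f) : ∫⁻ p, f (p 0) ∂D.pathMeasure x = f x := by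
  have h := Kernel.traj_map_frestrictLe_apply (X := fun _ => X) (κ := fun n => D.step n) 0 0
    (fun _ => x)
  rw [Kernel.partialTraj_self, Kernel.id_apply] at h
  have hg : Measurable fun q : FinPath X 0 => f q.last := hf.comp (measurable_pi_apply _)
  have h2 := congrArg (fun μ => ∫⁻ q, f (FinPath.last q) ∂μ) h
  rw [lintegral_map hg (by fun_prop), lintegral_dirac' _ hg] at h2
  exact h2

end OneStep

/-! ### Cost models with finitely many states -/

/-- A description of a controlled process, up to the observables `state` and `incr`, by
transition probabilities `P` and expected costs `cost` on a finite set of states. -/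
structure CostModel {X L : Type*} [MeasurableSpace X] (C : ControlledProcess X L)
    (S : Type*) [Fintype S] [MeasurableSpace S] where
  goal : Set S
  state : X → S
  measurable_state : Measurable state
  incr : X → X → ℝ≥0∞
  measurable_incr : Measurable (Function.uncurry incr)
  P : S → L → S → ℝ≥0∞
  cost : S → L → ℝ≥0∞
  lintegral_incr : ∀ x l, C.enabled x l → state x ∉ goal →
    ∫⁻ y, incr x y ∂(C.law x l) = cost (state x) l
  lintegral_state : ∀ x l, C.enabled x l → ∀ u : S → ℝ≥0∞,
    ∫⁻ y, u (state y) ∂(C.law x l) = ∑ s', P (state x) l s' * u s'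

namespace CostModel

variable {X L S : Type*} [MeasurableSpace X] [Fintype L] [Fintype S] [MeasurableSpace S]
  [DiscreteMeasurableSpace S] {C : ControlledProcess X L}

open Classical in
/-- The stationary deterministic policy that follows the selector `a`. -/
def stationaryPolicy (m : C.CostModel S) (a : S → L) (ha : ∀ x, C.enabled x (a (m.state x))) :
    C.Policy where
  choice _ h := PMF.pure (a (m.state h.last))
  measurable_choice n l := (measurable_of_countable fun s => PMF.pure (a s) l).comp
    (m.measurable_state.comp (measurable_pi_apply _))
  enabled_of_choice n h l hl := by
    have : l = a (m.state h.last) := by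
      by_contra hne
      exact hl (by simp [PMF.pure_apply, hne])
    exact this ▸ ha _

/-- The expected value of `u` after one step. -/
def next (m : C.CostModel S) (u : S → ℝ≥0∞) (s : S) (l : L) : ℝ≥0∞ := ∑ s', m.P s l s' * u s'

/-- The paths that avoid the goal up to index `n`. -/
def alive (m : C.CostModel S) (n : ℕ) : Set (ℕ → X) := {p | ∀ i ≤ n, m.state (p i) ∉ m.goal}

/-- The finite paths that avoid the goal. -/
def aliveFin (m : C.CostModel S) (n : ℕ) : Set (FinPath X n) := {h | ∀ i, m.state (h i) ∉ m.goal}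

open Classical in
/-- The cost accumulated before reaching the goal, `∞` if the goal is not reached. -/
def totalCost (m : C.CostModel S) (p : ℕ → X) : ℝ≥0∞ :=
  if h : ∃ k, m.state (p k) ∈ m.goal then
    ∑ j ∈ Finset.range (Nat.find h), m.incr (p j) (p (j + 1))
  else ⊤

/-- The expectation of `F (sₙ, σₙ)` on the event that the goal is avoided up to index `n`. -/
def occ (m : C.CostModel S) (D : C.Policy) (x : X) (n : ℕ) (F : S → L → ℝ≥0∞) : ℝ≥0∞ :=
  ∫⁻ p, (m.alive n).indicator
    (fun p => ∑ l, D.choice n (Preorder.frestrictLe n p) l * F (m.state (p n)) l) p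
    ∂D.pathMeasure x

/-! ### Expectations on the event of avoiding the goal, and their recursion -/

variable (m : C.CostModel S) (D : C.Policy) (x : X)

lemma alive_eq_preimage (n : ℕ) :
    m.alive n = Preorder.frestrictLe (π := fun _ => X) n ⁻¹' m.aliveFin n := by
  ext p
  simp [alive, aliveFin]

lemma measurableSet_aliveFin (n : ℕ) : MeasurableSet (m.aliveFin n) := by
  have : m.aliveFin n = ⋂ i, {h | m.state (h i) ∉ m.goal} := by ext; simp [aliveFin]
  rw [this]
  exact MeasurableSet.iInter fun i =>
    (m.measurable_state.comp (measurable_pi_apply i)) (MeasurableSet.of_discrete (s := m.goalᶜ))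

lemma measurableSet_alive (n : ℕ) : MeasurableSet (m.alive n) := by
  rw [alive_eq_preimage]
  exact Preorder.measurable_frestrictLe n (m.measurableSet_aliveFin n)

lemma antitone_alive : Antitone m.alive := fun _ _ hab _ hp i hi => hp i (hi.trans hab)

lemma measurable_comp_state (u : S → ℝ≥0∞) : Measurable fun y => u (m.state y) :=
  (measurable_of_countable u).comp m.measurable_state

lemma measurable_occ_integrand (n : ℕ) (F : S → L → ℝ≥0∞) :
    Measurable fun p : ℕ → X =>
      ∑ l, D.choice n (Preorder.frestrictLe n p) l * F (m.state (p n)) l := by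
  refine Finset.measurable_sum _ fun l _ => Measurable.mul ?_ ?_
  · exact (D.measurable_choice n l).comp (Preorder.measurable_frestrictLe n)
  · exact (m.measurable_comp_state fun s => F s l).comp (measurable_pi_apply n)

lemma occ_add (n : ℕ) (F F' : S → L → ℝ≥0∞) :
    m.occ D x n (fun s l => F s l + F' s l) = m.occ D x n F + m.occ D x n F' := by
  unfold occ
  rw [← lintegral_add_left ((m.measurable_occ_integrand D n F).indicator
    (m.measurableSet_alive n))]
  refine lintegral_congr fun p => ?_
  by_cases hp : p ∈ m.alive n <;> simp [hp, mul_add, Finset.sum_add_distrib]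

/-- The comparison is required only for labels with positive probability outside the goal. This lets
the same lemma serve bounds for all policies and bounds for one particular policy. -/
lemma occ_mono (n : ℕ) {F F' : S → L → ℝ≥0∞}
    (hF : ∀ h : FinPath X n, ∀ l, D.choice n h l ≠ 0 → m.state h.last ∉ m.goal →
      F (m.state h.last) l ≤ F' (m.state h.last) l) :
    m.occ D x n F ≤ m.occ D x n F' := by
  refine lintegral_mono fun p => ?_
  by_cases hp : p ∈ m.alive n
  · simp only [hp, Set.indicator_of_mem]
    refine Finset.sum_le_sum fun l _ => ?_
    by_cases hl : D.choice n (Preorder.frestrictLe n p) l = 0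
    · simp [hl]
    · exact mul_le_mul_right (hF _ l hl (hp n le_rfl)) _
  · simp [hp]

lemma sum_choice (n : ℕ) (h : FinPath X n) : ∑ l, D.choice n h l = 1 := by
  have := (D.choice n h).tsum_coe
  rwa [tsum_fintype] at this

lemma occ_const (n : ℕ) (u : S → ℝ≥0∞) :
    m.occ D x n (fun s _ => u s) =
      ∫⁻ p, (m.alive n).indicator (fun p => u (m.state (p n))) p ∂D.pathMeasure x := by
  simp only [occ, ← Finset.sum_mul, sum_choice, one_mul]

lemma occ_zero {u : S → ℝ≥0∞} (hu : ∀ s ∈ m.goal, u s = 0) :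
    m.occ D x 0 (fun s _ => u s) = u (m.state x) := by
  rw [occ_const, ← D.lintegral_pathMeasure_zero x (m.measurable_comp_state u)]
  refine lintegral_congr fun p => ?_
  by_cases hp : m.state (p 0) ∈ m.goal
  · simp [hu _ hp, Set.indicator]
  · rw [Set.indicator_of_mem]
    intro i hi
    rwa [Nat.le_zero.1 hi]

/-- Conditioning on the prefix: survival up to `n` depends on the prefix alone, so `g` may be
replaced by its conditional mean `F`. -/
lemma occ_step (n : ℕ) {g : X → X → ℝ≥0∞} (hg : Measurable (Function.uncurry g))
    {F : S → L → ℝ≥0∞} (hF : ∀ x l, C.enabled x l → m.state x ∉ m.goal →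
      ∫⁻ y, g x y ∂(C.law x l) = F (m.state x) l) :
    m.occ D x n F =
      ∫⁻ p, (m.alive n).indicator (fun p => g (p n) (p (n + 1))) p ∂D.pathMeasure x := by
  have hf : Measurable fun q : FinPath X n × X =>
      (Prod.fst ⁻¹' m.aliveFin n).indicator (fun q => g q.1.last q.2) q := by
    refine Measurable.indicator ?_ (measurable_fst (m.measurableSet_aliveFin n))
    have h1 : Measurable fun q : FinPath X n × X => (q.1.last, q.2) :=
      ((measurable_pi_apply _).comp measurable_fst).prodMk measurable_snd
    exact hg.comp h1
  have key := D.lintegral_pathMeasure_succ x n hf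
  have hmem : ∀ p, p ∈ m.alive n ↔ Preorder.frestrictLe n p ∈ m.aliveFin n := fun p => by
    rw [alive_eq_preimage]; rfl
  rw [occ]
  refine Eq.trans ?_ (key.symm.trans ?_)
  · refine lintegral_congr fun p => ?_
    rw [D.lintegral_step]
    by_cases hp : Preorder.frestrictLe n p ∈ m.aliveFin n
    · simp only [hmem, Set.indicator, Set.mem_preimage, hp, if_true]
      refine Finset.sum_congr rfl fun l _ => ?_
      by_cases hl : D.choice n (Preorder.frestrictLe n p) l = 0
      · simp [hl]
      · rw [hF _ l (D.enabled_of_choice _ _ _ hl) (hp _)]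
        rfl
    · simp [Set.indicator, hmem, hp]
  · refine lintegral_congr fun p => ?_
    by_cases hp : Preorder.frestrictLe n p ∈ m.aliveFin n
    · rw [Set.indicator_of_mem ((hmem p).2 hp), Set.indicator_of_mem (by exact hp)]
      rfl
    · rw [Set.indicator_of_notMem (mt (hmem p).1 hp), Set.indicator_of_notMem (by exact hp)]

lemma occ_cost (n : ℕ) :
    m.occ D x n m.cost =
      ∫⁻ p, (m.alive n).indicator (fun p => m.incr (p n) (p (n + 1))) p ∂D.pathMeasure x :=
  m.occ_step D x n m.measurable_incr m.lintegral_incr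

/-- Since `u` vanishes on the goal, paths entering it in this step contribute nothing, and survival
up to `n` can be traded for survival up to `n + 1`. -/
lemma occ_next (n : ℕ) {u : S → ℝ≥0∞} (hu : ∀ s ∈ m.goal, u s = 0) :
    m.occ D x n (m.next u) = m.occ D x (n + 1) (fun s _ => u s) := by
  rw [m.occ_step D x n (g := fun _ y => u (m.state y))
    ((m.measurable_comp_state u).comp measurable_snd)
    (fun x l hl _ => m.lintegral_state x l hl u), occ_const]
  refine lintegral_congr fun p => ?_
  by_cases hp : p ∈ m.alive n
  · by_cases hs : m.state (p (n + 1)) ∈ m.goal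
    · simp [Set.indicator, hu _ hs]
    · have : p ∈ m.alive (n + 1) := fun i hi => by
        rcases Nat.le_succ_iff.1 hi with h | h
        · exact hp i h
        · rwa [h]
      simp [hp, this]
  · have : p ∉ m.alive (n + 1) := fun h => hp (m.antitone_alive n.le_succ h)
    simp [hp, this]

lemma occ_cost_add_next (n : ℕ) {u : S → ℝ≥0∞} (hu : ∀ s ∈ m.goal, u s = 0) :
    m.occ D x n (fun s l => m.cost s l + m.next u s l) =
      m.occ D x n m.cost + m.occ D x (n + 1) (fun s _ => u s) := by
  rw [occ_add, occ_next m D x n hu]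

/-- The cost accumulated before reaching the goal, finite or not. -/
def partialCost (p : ℕ → X) : ℝ≥0∞ :=
  ∑' n, (m.alive n).indicator (fun p => m.incr (p n) (p (n + 1))) p

lemma lintegral_partialCost :
    ∫⁻ p, m.partialCost p ∂D.pathMeasure x = ∑' n, m.occ D x n m.cost := by
  simp only [partialCost, occ_cost]
  refine lintegral_tsum fun n => Measurable.aemeasurable ?_
  refine Measurable.indicator ?_ (m.measurableSet_alive n)
  have h1 : Measurable fun p : ℕ → X => (p n, p (n + 1)) :=
    (measurable_pi_apply n).prodMk (measurable_pi_apply (n + 1))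
  exact m.measurable_incr.comp h1

lemma totalCost_eq_partialCost {p : ℕ → X} (h : ∃ k, m.state (p k) ∈ m.goal) :
    m.totalCost p = m.partialCost p := by
  classical
  rw [totalCost, dif_pos h, partialCost, tsum_eq_sum (s := Finset.range (Nat.find h))]
  · refine Finset.sum_congr rfl fun j hj => ?_
    rw [Set.indicator_of_mem]
    exact fun i hi => Nat.find_min h (hi.trans_lt (Finset.mem_range.1 hj))
  · intro j hj
    rw [Set.indicator_of_notMem]
    exact fun hp => hp _ (not_lt.1 (Finset.mem_range.not.1 hj)) (Nat.find_spec h)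

lemma partialCost_le_totalCost (p : ℕ → X) : m.partialCost p ≤ m.totalCost p := by
  by_cases h : ∃ k, m.state (p k) ∈ m.goal
  · exact (m.totalCost_eq_partialCost h).ge
  · simp [totalCost, h]

/-- Finite-horizon lower bounds of the expected cost, valid for all policies. -/
theorem le_lintegral_totalCost {u : ℕ → S → ℝ≥0∞} (hu0 : ∀ s, u 0 s = 0)
    (hgoal : ∀ n, ∀ s ∈ m.goal, u n s = 0)
    (hu : ∀ n x l, C.enabled x l → m.state x ∉ m.goal →
      u (n + 1) (m.state x) ≤ m.cost (m.state x) l + m.next (u n) (m.state x) l) (n : ℕ) :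
    u n (m.state x) ≤ ∫⁻ p, m.totalCost p ∂D.pathMeasure x := by
  -- Cost already paid in `k` steps plus the bound for the remaining horizon `n - k`; at `k = n` the
  -- second term is zero.
  have key : ∀ k ≤ n, u n (m.state x) ≤
      ∑ j ∈ Finset.range k, m.occ D x j m.cost + m.occ D x k (fun s _ => u (n - k) s) := by
    intro k
    induction k with
    | zero => intro _; simp [occ_zero m D x (hgoal n)]
    | succ k ih =>
      intro hk
      refine (ih (Nat.le_of_succ_le hk)).trans ?_
      rw [Finset.sum_range_succ, add_assoc, ← occ_cost_add_next m D x k (hgoal _)]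
      gcongr
      refine m.occ_mono D x k fun h l hl hs => ?_
      have := hu (n - (k + 1)) h.last l (D.enabled_of_choice _ _ _ hl) hs
      rwa [show n - (k + 1) + 1 = n - k by lia] at this
  calc u n (m.state x) ≤ _ := key n le_rfl
    _ = ∑ j ∈ Finset.range n, m.occ D x j m.cost := by simp [hu0, occ_const]
    _ ≤ ∑' j, m.occ D x j m.cost := ENNReal.sum_le_tsum _
    _ = ∫⁻ p, m.partialCost p ∂D.pathMeasure x := (m.lintegral_partialCost D x).symm
    _ ≤ _ := lintegral_mono m.partialCost_le_totalCost

/-- Supermartingale argument. It controls only the cost paid before the goal and does not show that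
the goal is reached. -/
lemma sum_occ_cost_le {v : S → ℝ≥0∞} (hgoal : ∀ s ∈ m.goal, v s = 0)
    (hv : ∀ n, ∀ h : FinPath X n, ∀ l, D.choice n h l ≠ 0 → m.state h.last ∉ m.goal →
      m.cost (m.state h.last) l + m.next v (m.state h.last) l ≤ v (m.state h.last)) (n : ℕ) :
    ∑ j ∈ Finset.range n, m.occ D x j m.cost ≤ v (m.state x) := by
  have key : ∑ j ∈ Finset.range n, m.occ D x j m.cost + m.occ D x n (fun s _ => v s) ≤
      v (m.state x) := by
    induction n with
    | zero => simp [occ_zero m D x hgoal]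
    | succ n ih =>
      refine le_trans ?_ ih
      rw [Finset.sum_range_succ, add_assoc, ← occ_cost_add_next m D x n hgoal]
      gcongr
      exact m.occ_mono D x n fun h l hl hs => hv n h l hl hs
  exact le_self_add.trans key

/-- If a potential `w` grows by less than the cost minus `ε`, then a finite expected cost forces
the goal to be reached almost surely. -/
lemma measure_never_eq_zero {w : S → ℝ≥0∞} {ε b : ℝ≥0∞} (hε : ε ≠ 0) (hb : b ≠ ⊤)
    (hgoal : ∀ s ∈ m.goal, w s = 0) (hw : w (m.state x) ≠ ⊤)
    (hpot : ∀ x l, C.enabled x l → m.state x ∉ m.goal →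
      ε + m.next w (m.state x) l ≤ m.cost (m.state x) l + w (m.state x))
    (hcost : ∀ n, ∑ j ∈ Finset.range n, m.occ D x j m.cost ≤ b) :
    D.pathMeasure x (⋂ n, m.alive n) = 0 := by
  set q := D.pathMeasure x (⋂ n, m.alive n)
  have hq : ∀ n, ε * q ≤ m.occ D x n (fun _ _ => ε) := by
    intro n
    rw [occ_const, lintegral_indicator (m.measurableSet_alive n), lintegral_const,
      Measure.restrict_apply_univ]
    exact mul_le_mul_right (measure_mono (Set.iInter_subset _ n)) _
  -- Each step on a surviving path gains `ε`, while the potential telescopes. If `q` were positive,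
  -- the left side would grow linearly in `n` against a bounded right side.
  have key : ∀ n : ℕ, n * (ε * q) + m.occ D x n (fun s _ => w s) ≤
      ∑ j ∈ Finset.range n, m.occ D x j m.cost + w (m.state x) := by
    intro n
    induction n with
    | zero => simp [occ_zero m D x hgoal]
    | succ n ih =>
      have h1 : m.occ D x n (fun s l => ε + m.next w s l) ≤
          m.occ D x n (fun s l => m.cost s l + w s) :=
        m.occ_mono D x n fun h l hl hs => hpot _ _ (D.enabled_of_choice _ _ _ hl) hs
      rw [occ_add, occ_add, occ_next m D x n hgoal] at h1
      rw [Finset.sum_range_succ]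
      push_cast
      calc ((n : ℝ≥0∞) + 1) * (ε * q) + m.occ D x (n + 1) (fun s _ => w s)
          = n * (ε * q) + (ε * q + m.occ D x (n + 1) (fun s _ => w s)) := by ring
        _ ≤ n * (ε * q) + (m.occ D x n m.cost + m.occ D x n (fun s _ => w s)) := by
          exact add_le_add_right ((add_le_add_left (hq n) _).trans h1) _
        _ = (n * (ε * q) + m.occ D x n (fun s _ => w s)) + m.occ D x n m.cost := by ring
        _ ≤ (∑ j ∈ Finset.range n, m.occ D x j m.cost + w (m.state x)) +
            m.occ D x n m.cost := by gcongr
        _ = _ := by ring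
  by_contra hne
  obtain ⟨n, hn⟩ := ENNReal.exists_nat_mul_gt (mul_ne_zero hε hne)
    (ENNReal.add_ne_top.2 ⟨hb, hw⟩)
  exact absurd (le_self_add.trans ((key n).trans (by gcongr; exact hcost n))) (not_le.2 hn)

/-- A policy that is conserving for a finite supersolution `v` has expected cost at most `v`. -/
theorem lintegral_totalCost_le {v w : S → ℝ≥0∞} {ε : ℝ≥0∞} (hε : ε ≠ 0)
    (hvgoal : ∀ s ∈ m.goal, v s = 0)
    (hv : ∀ n, ∀ h : FinPath X n, ∀ l, D.choice n h l ≠ 0 → m.state h.last ∉ m.goal →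
      m.cost (m.state h.last) l + m.next v (m.state h.last) l ≤ v (m.state h.last))
    (hwgoal : ∀ s ∈ m.goal, w s = 0) (hw : ∀ s, w s ≠ ⊤)
    (hpot : ∀ x l, C.enabled x l → m.state x ∉ m.goal →
      ε + m.next w (m.state x) l ≤ m.cost (m.state x) l + w (m.state x)) :
    ∫⁻ p, m.totalCost p ∂D.pathMeasure x ≤ v (m.state x) := by
  by_cases htop : v (m.state x) = ⊤
  · simp [htop]
  have hsum := m.sum_occ_cost_le D x hvgoal hv
  have hnull := m.measure_never_eq_zero D x hε htop hwgoal (hw _) hpot hsum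
  -- The two costs differ at most on the null set of paths that never reach the goal.
  have hae : ∀ᵐ p ∂D.pathMeasure x, m.totalCost p = m.partialCost p := by
    rw [ae_iff]
    refine measure_mono_null (fun p hp => ?_) hnull
    refine Set.mem_iInter.2 fun n i _ hi => hp (m.totalCost_eq_partialCost ⟨i, hi⟩)
  rw [lintegral_congr_ae hae, lintegral_partialCost]
  exact ENNReal.tsum_le_of_sum_range_le hsum

end CostModel

end ControlledProcess

/-! ### The automaton and its shortest path problem as cost models -/

/-- Multiplying the Gamma(1, r) density by `t` gives `1/r` times the Gamma(2, r) density, which has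
total mass one. -/
lemma lintegral_ofReal_expMeasure {r : ℝ} (hr : 0 < r) :
    ∫⁻ t, ENNReal.ofReal t ∂(expMeasure r) = ENNReal.ofReal (1 / r) := by
  have hmeas : ∀ a : ℝ, Measurable (gammaPDF a r) := fun a =>
    (measurable_gammaPDFReal a r).ennreal_ofReal
  have hpt : ∀ t : ℝ, gammaPDF 1 r t * ENNReal.ofReal t =
      ENNReal.ofReal (1 / r) * gammaPDF 2 r t := by
    intro t
    rcases lt_or_ge t 0 with ht | ht
    · simp [gammaPDF_of_neg ht]
    · rw [gammaPDF_of_nonneg ht, gammaPDF_of_nonneg ht, ← ENNReal.ofReal_mul (by positivity),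
        ← ENNReal.ofReal_mul (by positivity)]
      congr 1
      have h2 : (2 : ℝ) - 1 = 1 := by norm_num
      have h3 : r ^ (2 : ℝ) = r * r := by
        rw [Real.rpow_two, sq]
      simp only [Real.rpow_one, Real.Gamma_one, sub_self, Real.rpow_zero, h2, h3, Real.Gamma_two]
      field_simp
  rw [expMeasure, gammaMeasure, lintegral_withDensity_eq_lintegral_mul _ (hmeas 1)
    ENNReal.measurable_ofReal]
  simp only [Pi.mul_apply, hpt]
  rw [lintegral_const_mul _ (hmeas 2), lintegral_gammaPDF_eq_one two_pos hr, mul_one]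

namespace MarkovAutomaton

variable {S A : Type*} [Fintype S] (M : MarkovAutomaton S A) (G : Set S)

/-- The expected sojourn time in `s` if `s` is left with the label `σ`. -/
def stageCost (s : S) : Option A → ℝ≥0∞
  | none => ((1 / M.exitRate s : ℝ≥0) : ℝ≥0∞)
  | some _ => 0

lemma lintegral_sojourn {s : S} {σ : Option A} (h : M.Enabled s σ) :
    ∫⁻ t, (t : ℝ≥0∞) ∂(M.sojourn s σ) = M.stageCost s σ := by
  cases σ with
  | none =>
    have hpos := M.exitRate_pos h
    rw [sojourn, lintegral_map measurable_coe_nnreal_ennreal measurable_real_toNNReal]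
    refine (lintegral_ofReal_expMeasure (NNReal.coe_pos.2 hpos)).trans ?_
    rw [stageCost, ← NNReal.coe_one, ← NNReal.coe_div, ENNReal.ofReal_coe_nnreal]
  | some α => simp [sojourn, stageCost]

variable [MeasurableSpace S] [DiscreteMeasurableSpace S]

lemma lintegral_law (x : Option A × ℝ≥0 × S) (σ : Option A)
    {f : Option A × ℝ≥0 × S → ℝ≥0∞} (hf : Measurable f) :
    ∫⁻ y, f y ∂(M.controlled.law x σ) =
      ∑ s', M.P x.2.2 σ s' * ∫⁻ t, f (σ, t, s') ∂(M.sojourn x.2.2 σ) := by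
  change ∫⁻ y, f y ∂(∑ s', M.P x.2.2 σ s' • (M.sojourn x.2.2 σ).map fun t => (σ, t, s')) = _
  rw [lintegral_finsetSum_measure]
  refine Finset.sum_congr rfl fun s' _ => ?_
  rw [lintegral_smul_measure, lintegral_map hf (by fun_prop), smul_eq_mul]

/-- The cost model of a Markov automaton in which the cost is the elapsed time. -/
def timeModel : M.controlled.CostModel S where
  goal := G
  state x := x.2.2
  measurable_state := measurable_snd.comp measurable_snd
  incr _ y := y.2.1
  measurable_incr := by unfold Function.uncurry; fun_prop
  P := M.P
  cost := M.stageCost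
  lintegral_incr x σ h _ := by
    rw [M.lintegral_law x σ (by fun_prop)]
    simp only [M.lintegral_sojourn h]
    rw [← Finset.sum_mul, M.sum_P_of_enabled h, one_mul]
  lintegral_state x σ h u := by
    have hu : Measurable u := measurable_of_countable u
    have := M.isProb_sojourn h
    rw [M.lintegral_law x σ (by fun_prop)]
    simp

lemma entryTime_mono (x : ℕ → Option A × ℝ≥0 × S) : Monotone (entryTime x) :=
  monotone_nat_of_le_succ fun n => by simp [entryTime, Finset.sum_range_succ]

/-- Occupation intervals are closed, so the infimum is attained at the entry time of the first goal
state; later goal visits have larger entry times by monotonicity. -/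
lemma totalCost_timeModel (x : ℕ → Option A × ℝ≥0 × S) :
    (M.timeModel G).totalCost x = timeTo G x := by
  classical
  unfold ControlledProcess.CostModel.totalCost
  split_ifs with h
  · change ∑ j ∈ Finset.range (Nat.find h), (((x (j + 1)).2.1 : ℝ≥0) : ℝ≥0∞) = _
    rw [← ENNReal.ofNNReal_finsetSum]
    change (entryTime x (Nat.find h) : ℝ≥0∞) = _
    refine le_antisymm (le_iInf₂ fun t ⟨s, hs, n, hn, ht, _⟩ => ?_) (iInf₂_le _ ?_)
    · refine ENNReal.coe_le_coe.2 ((entryTime_mono x (Nat.find_min' h ?_)).trans ht)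
      change state x n ∈ G
      rwa [hn]
    · exact ⟨_, Nat.find_spec h, Nat.find h, rfl, le_rfl, entryTime_mono x (Nat.le_succ _)⟩
  · refine (iInf₂_eq_top.2 fun t ⟨s, hs, n, hn, _⟩ => absurd ⟨n, ?_⟩ h).symm
    change state x n ∈ G
    rwa [hn]

lemma enabled_sspEt_iff (x : Option A × S) (σ : Option A) :
    (M.sspEt G).controlled.enabled x σ ↔ M.Enabled x.2 σ := by
  refine ⟨fun h => ?_, M.sum_P_of_enabled⟩
  rcases M.sum_P x.2 σ with h' | h'
  · exact h'.1
  · have h2 : ∑ s', M.P x.2 σ s' = 1 := h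
    simp [h'] at h2

lemma lintegral_law_sspEt [Finite A] (x : Option A × S) (σ : Option A)
    (f : Option A × S → ℝ≥0∞) :
    ∫⁻ y, f y ∂((M.sspEt G).controlled.law x σ) = ∑ s', M.P x.2 σ s' * f (σ, s') := by
  have hf : Measurable f := measurable_of_countable f
  change ∫⁻ y, f y ∂(∑ s', M.P x.2 σ s' • Measure.dirac (σ, s')) = _
  rw [lintegral_finsetSum_measure]
  refine Finset.sum_congr rfl fun s' _ => ?_
  rw [lintegral_smul_measure, lintegral_dirac' _ hf, smul_eq_mul]

lemma cost_sspEt {s : S} {σ : Option A} (h : M.Enabled s σ) (hs : s ∉ G) :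
    (((M.sspEt G).cost s σ : ℝ≥0) : ℝ≥0∞) = M.stageCost s σ := by
  cases σ with
  | none =>
    have hMS : s ∈ M.MS := h
    simp [sspEt, stageCost, hMS, hs]
  | some α => simp [sspEt, stageCost]

/-- The cost model of the stochastic shortest path problem of a Markov automaton. -/
def sspModel [Finite A] : (M.sspEt G).controlled.CostModel S where
  goal := G
  state x := x.2
  measurable_state := measurable_snd
  incr x y := (M.sspEt G).cost x.2 y.1
  measurable_incr :=
    (measurable_of_countable fun q : S × Option A =>
      (((M.sspEt G).cost q.1 q.2 : ℝ≥0) : ℝ≥0∞)).comp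
      ((measurable_snd.comp measurable_fst).prodMk (measurable_fst.comp measurable_snd))
  P := M.P
  cost := M.stageCost
  -- In goal states the cost of the problem is zero but `stageCost` is not; `hx` excludes them.
  lintegral_incr x σ h hx := by
    have h' := (M.enabled_sspEt_iff G x σ).1 h
    rw [lintegral_law_sspEt]
    simp only [M.cost_sspEt G h' hx]
    rw [← Finset.sum_mul, M.sum_P_of_enabled h', one_mul]
  lintegral_state x σ _ u := M.lintegral_law_sspEt G x σ fun y => u y.2

lemma totalCost_sspModel [Finite A] (x : ℕ → Option A × S) :
    (M.sspModel G).totalCost x = (M.sspEt G).accCost x := by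
  unfold ControlledProcess.CostModel.totalCost SSP.accCost
  by_cases h : ∃ k, (x k).2 ∈ G
  · have h₁ : ∃ k, (M.sspModel G).state (x k) ∈ (M.sspModel G).goal := h
    have h₂ : ∃ k, (x k).2 ∈ (M.sspEt G).goal := h
    rw [dif_pos h₁, dif_pos h₂]
    exact (add_zero _).symm
  · have h₁ : ¬∃ k, (M.sspModel G).state (x k) ∈ (M.sspModel G).goal := h
    have h₂ : ¬∃ k, (x k).2 ∈ (M.sspEt G).goal := h
    rw [dif_neg h₁, dif_neg h₂]

end MarkovAutomaton

namespace MarkovAutomaton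

variable {S A : Type*} [Fintype S] (M : MarkovAutomaton S A) (G : Set S)

/-! ### The Bellman operator on non-negative functions -/

/-- The expected value of `v` after leaving `s` with the label `σ`. -/
def mean (v : S → ℝ≥0∞) (s : S) (σ : Option A) : ℝ≥0∞ := ∑ s', M.P s σ s' * v s'

lemma mean_mono {v w : S → ℝ≥0∞} (h : v ≤ w) (s : S) (σ : Option A) :
    M.mean v s σ ≤ M.mean w s σ :=
  Finset.sum_le_sum fun s' _ => mul_le_mul_right (h s') _

lemma mean_add (v w : S → ℝ≥0∞) (s : S) (σ : Option A) :
    M.mean (fun s => v s + w s) s σ = M.mean v s σ + M.mean w s σ := by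
  simp [mean, mul_add, Finset.sum_add_distrib]

lemma mean_const_mul (c : ℝ≥0∞) (v : S → ℝ≥0∞) (s : S) (σ : Option A) :
    M.mean (fun s => c * v s) s σ = c * M.mean v s σ := by
  simp only [mean, Finset.mul_sum]
  exact Finset.sum_congr rfl fun _ _ => by ring

open Classical in
/-- The Bellman operator on functions with values in `[0, ∞]`. -/
def bellmanENN (v : S → ℝ≥0∞) (s : S) : ℝ≥0∞ :=
  if s ∈ G then 0 else ⨅ σ : {σ // M.Enabled s σ}, (M.stageCost s σ + M.mean v s σ)

lemma bellmanENN_goal {s : S} (hs : s ∈ G) (v : S → ℝ≥0∞) : M.bellmanENN G v s = 0 := by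
  simp [bellmanENN, hs]

lemma bellmanENN_le {s : S} (hs : s ∉ G) {σ : Option A} (h : M.Enabled s σ) (v : S → ℝ≥0∞) :
    M.bellmanENN G v s ≤ M.stageCost s σ + M.mean v s σ := by
  rw [bellmanENN, if_neg hs]
  exact iInf_le (fun σ : {σ // M.Enabled s σ} => M.stageCost s σ + M.mean v s σ) ⟨σ, h⟩

lemma monotone_bellmanENN : Monotone (M.bellmanENN G) := by
  intro v w h s
  unfold bellmanENN
  split_ifs
  · exact le_rfl
  · exact iInf_mono fun σ => add_le_add_right (M.mean_mono h s σ) _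

lemma mean_iSup {v : ℕ → S → ℝ≥0∞} (hv : Monotone v) (s : S) (σ : Option A) :
    M.mean (fun s => ⨆ n, v n s) s σ = ⨆ n, M.mean (v n) s σ := by
  simp only [mean, ENNReal.mul_iSup]
  exact ENNReal.finsetSum_iSup_of_monotone fun s' _ _ h => mul_le_mul_right (hv h s') _

/-- A minimum over finitely many labels commutes with increasing suprema. This continuity makes the
limit after `ω` iterations a fixpoint. -/
lemma bellmanENN_iSup [Finite A] {v : ℕ → S → ℝ≥0∞} (hv : Monotone v) (s : S) :
    M.bellmanENN G (fun s => ⨆ n, v n s) s = ⨆ n, M.bellmanENN G (v n) s := by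
  unfold bellmanENN
  split_ifs
  · simp
  · rw [iSup_iInf_of_monotone]
    · simp only [M.mean_iSup hv, ENNReal.add_iSup]
    · exact fun σ _ _ h => add_le_add_right (M.mean_mono (hv h) s σ) _

/-- The limit of value iteration from `0`. -/
def value (s : S) : ℝ≥0∞ := ⨆ n, (M.bellmanENN G)^[n] 0 s

lemma monotone_iterate_bellmanENN : Monotone fun n => (M.bellmanENN G)^[n] 0 :=
  (M.monotone_bellmanENN G).monotone_iterate_of_le_map fun _ => zero_le

lemma bellmanENN_value [Finite A] : M.bellmanENN G (M.value G) = M.value G := by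
  ext s
  change M.bellmanENN G (fun s => ⨆ n, (M.bellmanENN G)^[n] 0 s) s = _
  rw [M.bellmanENN_iSup G (M.monotone_iterate_bellmanENN G)]
  simp only [← Function.iterate_succ_apply' (M.bellmanENN G), value]
  have h := (M.monotone_iterate_bellmanENN G)
  refine le_antisymm (iSup_le fun n => le_iSup (fun n => (M.bellmanENN G)^[n] 0 s) (n + 1))
    (iSup_le fun n => le_iSup_of_le n (h n.le_succ s))

lemma value_goal {s : S} (hs : s ∈ G) : M.value G s = 0 := by
  refine ENNReal.iSup_eq_zero.2 fun n => ?_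
  cases n with
  | zero => rfl
  | succ n => rw [Function.iterate_succ_apply', bellmanENN_goal M G hs]

lemma value_le_of_fixed {u : S → ℝ≥0∞} (hu : M.bellmanENN G u = u) : M.value G ≤ u := by
  refine fun s => iSup_le fun n => ?_
  have : (M.bellmanENN G)^[n] 0 ≤ u := by
    induction n with
    | zero => exact fun _ => zero_le
    | succ n ih =>
      rw [Function.iterate_succ_apply', ← hu]
      exact M.monotone_bellmanENN G ih
  exact this s

/-! ### Greedy selectors -/

lemma exists_enabled (hstates : ∀ s, s ∈ M.PS ∨ s ∈ M.MS) (s : S) : ∃ σ, M.Enabled s σ := by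
  rcases hstates s with ⟨α, μ, h⟩ | h
  · exact ⟨some α, μ, h⟩
  · exact ⟨none, h⟩

lemma exists_greedy [Finite A] (hstates : ∀ s, s ∈ M.PS ∨ s ∈ M.MS) (v : S → ℝ≥0∞) :
    ∃ a : S → Option A, (∀ s, M.Enabled s (a s)) ∧
      ∀ s ∉ G, M.stageCost s (a s) + M.mean v s (a s) = M.bellmanENN G v s := by
  have h : ∀ s, ∃ σ, M.Enabled s σ ∧
      (s ∉ G → M.stageCost s σ + M.mean v s σ = M.bellmanENN G v s) := by
    intro s
    obtain ⟨σ, hσ⟩ := M.exists_enabled hstates s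
    have : Nonempty {σ // M.Enabled s σ} := ⟨⟨σ, hσ⟩⟩
    obtain ⟨τ, hτ⟩ := exists_eq_ciInf_of_finite
      (f := fun σ : {σ // M.Enabled s σ} => M.stageCost s σ + M.mean v s σ)
    exact ⟨τ, τ.2, fun hs => by rw [bellmanENN, if_neg hs]; exact hτ⟩
  choose a ha using h
  exact ⟨a, fun s => (ha s).1, fun s => (ha s).2⟩

/-! ### A potential function for non-Zeno automata -/

/-- The number of states that are reachable by a non-empty sequence of probabilistic edges. -/
def rank (s : S) : ℕ := {s' | Relation.TransGen M.ProbEdge s s'}.ncard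

variable {M}

/-- Everything reachable from `s'` is reachable from `s`, and `s'` itself is reachable from `s` but,
without cycles, not from `s'`. -/
lemma NonZeno.rank_lt (h : M.NonZeno) {s s' : S} (he : M.ProbEdge s s') :
    M.rank s' < M.rank s := by
  refine Set.ncard_lt_ncard ⟨fun t ht => Relation.TransGen.head he ht, fun hsub => ?_⟩
    (Set.toFinite _)
  exact h s' (hsub (Relation.TransGen.single he))

variable (M)

lemma rank_le_card (s : S) : M.rank s ≤ Fintype.card S := by
  rw [← Nat.card_eq_fintype_card]
  exact Set.ncard_le_card _

/-- The amount by which `potential` decreases in each step, up to the cost of the step. -/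
def gap : ℝ≥0∞ := (1 + ∑ s, (M.exitRate s : ℝ≥0∞))⁻¹ / (Fintype.card S + 1)

lemma gap_ne_zero : M.gap ≠ 0 := by
  refine (ENNReal.div_pos (ENNReal.inv_ne_zero.2 ?_) ?_).ne'
  · exact ENNReal.add_ne_top.2 ⟨ENNReal.one_ne_top,
      ENNReal.sum_ne_top.2 fun _ _ => ENNReal.coe_ne_top⟩
  · exact_mod_cast ENNReal.natCast_ne_top (Fintype.card S + 1)

lemma gap_ne_top : M.gap ≠ ⊤ :=
  ENNReal.div_ne_top (ENNReal.inv_ne_top.2 (by simp)) (by simp)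

/-- The choice of `gap` aims at this: the potential never exceeds `card S * gap`, so one Markovian
sojourn pays for any rise of the potential and one further `gap`. -/
lemma card_add_one_mul_gap_le {s : S} (hs : s ∈ M.MS) :
    (Fintype.card S + 1) * M.gap ≤ M.stageCost s none := by
  rw [gap, ENNReal.mul_div_cancel (by simp) (by exact_mod_cast ENNReal.natCast_ne_top _)]
  rw [stageCost, one_div, ENNReal.coe_inv (M.exitRate_pos hs).ne']
  refine ENNReal.inv_le_inv.2 (le_trans ?_ le_add_self)
  exact Finset.single_le_sum (f := fun s => (M.exitRate s : ℝ≥0∞)) (fun _ _ => zero_le)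
    (Finset.mem_univ s)

open Classical in
/-- A bounded function that decreases along probabilistic transitions. -/
def potential (s : S) : ℝ≥0∞ := if s ∈ G then 0 else M.rank s * M.gap

lemma potential_goal {s : S} (hs : s ∈ G) : M.potential G s = 0 := if_pos hs

lemma potential_le_rank (s : S) : M.potential G s ≤ M.rank s * M.gap := by
  unfold potential; split_ifs <;> simp

lemma potential_ne_top (s : S) : M.potential G s ≠ ⊤ :=
  ne_top_of_le_ne_top (ENNReal.mul_ne_top (ENNReal.natCast_ne_top _) M.gap_ne_top)
    (M.potential_le_rank G s)

variable {M G}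

/-- A Markovian step is paid for by its cost; a probabilistic step is free but lowers the rank by at
least one. -/
lemma gap_add_mean_potential_le (hnz : M.NonZeno) {s : S} {σ : Option A} (h : M.Enabled s σ)
    (hs : s ∉ G) :
    M.gap + M.mean (M.potential G) s σ ≤ M.stageCost s σ + M.potential G s := by
  have hgap : M.gap + M.mean (M.potential G) s σ =
      ∑ s', M.P s σ s' * (M.gap + M.potential G s') := by
    simp only [mul_add, Finset.sum_add_distrib, ← Finset.sum_mul, M.sum_P_of_enabled h, one_mul,
      mean]
  rw [hgap]
  have hbound : ∀ c, (∀ s', M.P s σ s' ≠ 0 → M.gap + M.potential G s' ≤ c) →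
      ∑ s', M.P s σ s' * (M.gap + M.potential G s') ≤ c := by
    intro c hc
    calc _ ≤ ∑ s', M.P s σ s' * c := Finset.sum_le_sum fun s' _ => by
          by_cases h0 : M.P s σ s' = 0
          · simp [h0]
          · exact mul_le_mul_right (hc s' h0) _
      _ = c := by rw [← Finset.sum_mul, M.sum_P_of_enabled h, one_mul]
  have hsucc : ∀ s' n, M.rank s' ≤ n → M.gap + M.potential G s' ≤ (n + 1) * M.gap := by
    intro s' n hn
    rw [add_mul, one_mul, add_comm]
    gcongr
    exact (M.potential_le_rank G s').trans (by gcongr)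
  cases σ with
  | none =>
    exact (hbound _ fun s' _ => (hsucc s' _ (M.rank_le_card s')).trans
      (M.card_add_one_mul_gap_le h)).trans le_self_add
  | some α =>
    obtain ⟨μ, hμ⟩ := h
    refine (hbound _ fun s' h0 => ?_).trans le_add_self
    have hlt : M.rank s' < M.rank s := hnz.rank_lt ⟨α, μ, hμ, by simpa [P, hμ] using h0⟩
    obtain ⟨k, hk⟩ := Nat.exists_eq_add_of_lt hlt
    have := hsucc s' (M.rank s' + k) (Nat.le_add_right _ _)
    rw [show M.potential G s = M.rank s * M.gap from if_neg hs, hk]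
    exact_mod_cast this

/-! ### Optimality -/

section Optimality

variable [MeasurableSpace S] [DiscreteMeasurableSpace S] [Fintype A] {X : Type*}
  [MeasurableSpace X] {C : ControlledProcess X (Option A)} (m : C.CostModel S)

/-- The Bellman iterates serve as the finite-horizon bounds. Leaving the cost model arbitrary covers
elapsed time and shortest path cost at once. -/
lemma value_le_lintegral_totalCost (hP : m.P = M.P) (hc : m.cost = M.stageCost)
    (hg : m.goal = G) (he : ∀ x σ, C.enabled x σ → M.Enabled (m.state x) σ) (D : C.Policy)
    (x : X) : M.value G (m.state x) ≤ ∫⁻ p, m.totalCost p ∂D.pathMeasure x := by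
  have hnext : m.next = M.mean := by unfold ControlledProcess.CostModel.next mean; rw [hP]
  subst hg
  refine iSup_le fun n => m.le_lintegral_totalCost D x (u := fun n => (M.bellmanENN m.goal)^[n] 0)
    (fun _ => rfl) (fun n s hs => ?_) (fun n y σ hσ hy => ?_) n
  · exact le_zero_iff.1 ((le_iSup (fun n => (M.bellmanENN m.goal)^[n] 0 s) n).trans
      (M.value_goal m.goal hs).le)
  · rw [Function.iterate_succ_apply', hc, hnext]
    exact M.bellmanENN_le m.goal hy (he y σ hσ) _

lemma lintegral_totalCost_greedy (hP : m.P = M.P) (hc : m.cost = M.stageCost)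
    (hg : m.goal = G) (he : ∀ x σ, C.enabled x σ ↔ M.Enabled (m.state x) σ) (hnz : M.NonZeno)
    {a : S → Option A} (ha : ∀ s, M.Enabled s (a s))
    (hgreedy : ∀ s ∉ G, M.stageCost s (a s) + M.mean (M.value G) s (a s) = M.value G s) (x : X) :
    ∫⁻ p, m.totalCost p ∂(m.stationaryPolicy a fun x => (he x _).2 (ha _)).pathMeasure x =
      M.value G (m.state x) := by
  have hnext : m.next = M.mean := by unfold ControlledProcess.CostModel.next mean; rw [hP]
  subst hg
  refine le_antisymm ?_
    (value_le_lintegral_totalCost m hP hc rfl (fun x σ => (he x σ).1) _ x)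
  refine m.lintegral_totalCost_le _ x (w := M.potential m.goal) M.gap_ne_zero
    (fun s hs => M.value_goal m.goal hs) (fun n h σ hσ hs => ?_)
    (fun s hs => M.potential_goal m.goal hs) (M.potential_ne_top m.goal) (fun y σ hσ hy => ?_)
  · have : σ = a (m.state h.last) := by
      by_contra hne
      exact hσ (by simp [ControlledProcess.CostModel.stationaryPolicy, PMF.pure_apply, hne])
    rw [this, hc, hnext]
    exact (hgreedy _ hs).le
  · rw [hc, hnext]
    exact gap_add_mean_potential_le hnz ((he y σ).1 hσ) hy

end Optimality

end MarkovAutomaton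

/-! ### Sums, infima and averages in the extended reals -/

lemma EReal.coe_ennreal_iInf {ι : Sort*} (f : ι → ℝ≥0∞) :
    ((⨅ i, f i : ℝ≥0∞) : EReal) = ⨅ i, (f i : EReal) := by
  refine le_antisymm (le_iInf fun i => EReal.coe_ennreal_le_coe_ennreal_iff.2 (iInf_le f i)) ?_
  have h0 : (0 : EReal) ≤ ⨅ i, (f i : EReal) := le_iInf fun i => EReal.coe_ennreal_nonneg _
  rw [← EReal.coe_toENNReal h0, EReal.coe_ennreal_le_coe_ennreal_iff]
  refine le_iInf fun i => ?_
  rw [← EReal.coe_ennreal_le_coe_ennreal_iff, EReal.coe_toENNReal h0]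
  exact iInf_le _ i

lemma EReal.coe_ennreal_sum {ι : Type*} (s : Finset ι) (f : ι → ℝ≥0∞) :
    ((∑ i ∈ s, f i : ℝ≥0∞) : EReal) = ∑ i ∈ s, (f i : EReal) := by
  induction s using Finset.cons_induction with
  | empty => simp
  | cons a s ha ih => rw [Finset.sum_cons, Finset.sum_cons, EReal.coe_ennreal_add, ih]

lemma EReal.coe_sum {ι : Type*} (s : Finset ι) (f : ι → ℝ) :
    ((∑ i ∈ s, f i : ℝ) : EReal) = ∑ i ∈ s, (f i : EReal) := by
  induction s using Finset.cons_induction with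
  | empty => simp
  | cons a s ha ih => rw [Finset.sum_cons, Finset.sum_cons, EReal.coe_add, ih]

/-- An average of numbers `≥ r` is `≥ r`, and equality holds only if all numbers that occur with
positive weight equal `r`. -/
lemma EReal.le_weighted_sum {ι : Type*} [Fintype ι] {p : ι → ℝ≥0∞} (hp : ∑ i, p i = 1)
    {v : ι → EReal} {r : ℝ} (hv : ∀ i, (r : EReal) ≤ v i) :
    (r : EReal) ≤ ∑ i, (p i : EReal) * v i ∧
      (∑ i, (p i : EReal) * v i ≤ r → ∀ i, p i ≠ 0 → v i = r) := by
  -- Real surrogates for the values: `⊤` is replaced by `r + 1`, which preserves both the lower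
  -- bound and strictness, so the rest is real arithmetic.
  have hx : ∀ i, ∃ x : ℝ, r ≤ x ∧ (x : EReal) ≤ v i ∧ (x = r → v i = r) := by
    intro i
    have h := hv i
    induction hvi : v i with
    | bot => simp [hvi] at h
    | coe y => exact ⟨y, by simpa [hvi] using h, le_rfl, fun h => by rw [h]⟩
    | top => exact ⟨r + 1, by simp, le_top, fun h => by simp at h⟩
  choose x hrx hxv hxr using hx
  have hptop : ∀ i, p i ≠ ⊤ := fun i => ne_top_of_le_ne_top ENNReal.one_ne_top
    (hp ▸ Finset.single_le_sum (f := p) (fun _ _ => zero_le) (Finset.mem_univ i))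
  have hq : ∑ i, (p i).toReal = 1 := by
    rw [← ENNReal.toReal_sum fun i _ => hptop i, hp, ENNReal.toReal_one]
  have hle : ((∑ i, (p i).toReal * x i : ℝ) : EReal) ≤ ∑ i, (p i : EReal) * v i := by
    rw [EReal.coe_sum]
    refine Finset.sum_le_sum fun i _ => ?_
    rw [EReal.coe_mul, EReal.coe_ennreal_toReal (hptop i)]
    exact mul_le_mul_of_nonneg_left (hxv i) (EReal.coe_ennreal_nonneg _)
  have hnn : ∀ i ∈ Finset.univ, 0 ≤ (p i).toReal * (x i - r) := fun i _ =>
    mul_nonneg ENNReal.toReal_nonneg (_root_.sub_nonneg.2 (hrx i))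
  have hsum : ∑ i, (p i).toReal * (x i - r) = ∑ i, (p i).toReal * x i - r := by
    simp only [mul_sub, Finset.sum_sub_distrib]
    rw [← Finset.sum_mul, hq, one_mul]
  have hr : r ≤ ∑ i, (p i).toReal * x i := by
    have := Finset.sum_nonneg hnn
    linarith
  refine ⟨le_trans (EReal.coe_le_coe_iff.2 hr) hle, fun hub i hi => hxr i ?_⟩
  have h1 := EReal.coe_le_coe_iff.1 (hle.trans hub)
  have h2 : ∑ i, (p i).toReal * (x i - r) = 0 := by
    have := Finset.sum_nonneg hnn
    linarith
  have h3 := (Finset.sum_eq_zero_iff_of_nonneg hnn).1 h2 i (Finset.mem_univ i)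
  rcases mul_eq_zero.1 h3 with h | h
  · exact absurd h (ENNReal.toReal_ne_zero.2 ⟨hi, hptop i⟩)
  · linarith

/-! ### Extended-real fixpoints and uniqueness -/

namespace MarkovAutomaton

variable {S A : Type*} [Fintype S] {M : MarkovAutomaton S A} {G : Set S}

lemma bellmanENN_of_mem_MS {s : S} (hs : s ∉ G) (hMS : s ∈ M.MS) (v : S → ℝ≥0∞) :
    M.bellmanENN G v s = M.stageCost s none + M.mean v s none := by
  refine le_antisymm (M.bellmanENN_le G hs (σ := none) hMS v) ?_
  rw [bellmanENN, if_neg hs]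
  refine le_iInf fun ⟨σ, hσ⟩ => ?_
  cases σ with
  | none => exact le_rfl
  | some α => exact absurd ⟨α, hσ⟩ hMS.1

lemma bellmanENN_of_notMem_MS {s : S} (hs : s ∉ G) (hMS : s ∉ M.MS) (v : S → ℝ≥0∞) :
    M.bellmanENN G v s = ⨅ (α : A) (μ : PMF S) (_ : M.prob s α = some μ), ∑ s', μ s' * v s' := by
  refine le_antisymm (le_iInf fun α => le_iInf₂ fun μ hμ => ?_) ?_
  · refine (M.bellmanENN_le G hs (σ := some α) ⟨μ, hμ⟩ v).trans ?_
    simp [stageCost, mean, P, hμ]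
  · rw [bellmanENN, if_neg hs]
    refine le_iInf fun ⟨σ, hσ⟩ => ?_
    cases σ with
    | none => exact absurd hσ hMS
    | some α =>
      obtain ⟨μ, hμ⟩ := hσ
      refine iInf_le_of_le α (iInf₂_le_of_le μ hμ ?_)
      simp [stageCost, mean, P, hμ]

lemma bellman_coe (v : S → ℝ≥0∞) (s : S) :
    M.bellman G (fun s => (v s : EReal)) s = (M.bellmanENN G v s : ℝ≥0∞) := by
  by_cases hs : s ∈ G
  · simp [bellman, M.bellmanENN_goal G hs, hs]
  by_cases hMS : s ∈ M.MS
  · rw [bellmanENN_of_mem_MS hs hMS, bellman, if_neg hs, if_pos hMS, EReal.coe_ennreal_add, mean,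
      EReal.coe_ennreal_sum]
    simp only [EReal.coe_ennreal_mul]
    rfl
  · rw [bellmanENN_of_notMem_MS hs hMS, bellman, if_neg hs, if_neg hMS]
    simp only [EReal.coe_ennreal_iInf, EReal.coe_ennreal_sum, EReal.coe_ennreal_mul]

/-- The infimum is attained because an action determines its distribution, so the pairs indexing it
inject into `A`. -/
lemma exists_prob_of_bellman [Finite A] {s : S} (hs : s ∉ G) (hMS : s ∉ M.MS) (hPS : s ∈ M.PS)
    (v : S → EReal) :
    ∃ α μ, M.prob s α = some μ ∧ ∑ s', (μ s' : EReal) * v s' = M.bellman G v s := by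
  obtain ⟨α, μ, hμ⟩ := hPS
  let F : {q : A × PMF S // M.prob s q.1 = some q.2} → EReal := fun q =>
    ∑ s', (q.1.2 s' : EReal) * v s'
  have : Nonempty {q : A × PMF S // M.prob s q.1 = some q.2} := ⟨⟨(α, μ), hμ⟩⟩
  have : Finite {q : A × PMF S // M.prob s q.1 = some q.2} :=
    Finite.of_injective (fun q => q.1.1) fun q q' h => by
      obtain ⟨⟨a, ν⟩, h1⟩ := q
      obtain ⟨⟨b, ν'⟩, h2⟩ := q'
      obtain rfl : a = b := h
      obtain rfl : ν = ν' := Option.some.inj (h1.symm.trans h2)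
      rfl
  obtain ⟨q, hq⟩ := exists_eq_ciInf_of_finite (f := F)
  refine ⟨q.1.1, q.1.2, q.2, hq.trans ?_⟩
  rw [bellman, if_neg hs, if_neg hMS, iInf_subtype, iInf_prod]

/-- Suppose the minimum is negative, and take a minimiser of least rank. If it is Markovian, its
value exceeds the minimum by at least `1/E`. If it is probabilistic, an average equals the minimum,
so all its successors are minimisers, and they have smaller rank. -/
lemma nonneg_of_fixed [Finite A] (hstates : ∀ s, s ∈ M.PS ∨ s ∈ M.MS) (hnz : M.NonZeno)
    {v : S → EReal} (hv : M.bellman G v = v) (hbot : ∀ s, v s ≠ ⊥) (s : S) : 0 ≤ v s := by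
  by_contra! hneg
  have : Nonempty S := ⟨s⟩
  obtain ⟨s₀, hs₀⟩ := Finite.exists_min v
  have hm : v s₀ < 0 := (hs₀ s).trans_lt hneg
  obtain ⟨r, hr⟩ : ∃ r : ℝ, (r : EReal) = v s₀ :=
    ⟨_, EReal.coe_toReal (hm.trans_le le_top).ne (hbot s₀)⟩
  obtain ⟨t, ht, htmin⟩ := Set.exists_min_image {t | v t = r} M.rank (Set.toFinite _) ⟨s₀, hr.symm⟩
  have hle : ∀ s, (r : EReal) ≤ v s := fun s => hr ▸ hs₀ s
  have ht' : v t = r := ht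
  have htG : t ∉ G := fun h => by
    have h1 := congrFun hv t
    rw [bellman, if_pos h, ht', hr] at h1
    exact hm.ne h1.symm
  by_cases hMS : t ∈ M.MS
  · have h1 := congrFun hv t
    rw [bellman, if_neg htG, if_pos hMS, ht'] at h1
    have h2 := (EReal.le_weighted_sum (M.sum_P_of_enabled (s := t) (σ := none) hMS) hle).1
    have hc : (0 : ℝ) < (1 / M.exitRate t : ℝ≥0) :=
      NNReal.coe_pos.2 (div_pos one_pos (M.exitRate_pos hMS))
    have h3 : (((1 / M.exitRate t : ℝ≥0) : ℝ) : EReal) + r ≤ r := by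
      conv_rhs => rw [← h1]
      exact add_le_add_right h2 _
    rw [← EReal.coe_add, EReal.coe_le_coe_iff] at h3
    linarith
  · obtain ⟨α, μ, hμ, hsum⟩ := exists_prob_of_bellman (M := M) htG hMS
      ((hstates t).resolve_right hMS) v
    rw [hv, ht'] at hsum
    have hp : ∑ s', μ s' = 1 := (tsum_fintype _).symm.trans μ.tsum_coe
    have h2 := (EReal.le_weighted_sum hp hle).2 hsum.le
    obtain ⟨t', ht'⟩ := μ.support_nonempty
    have h0 : μ t' ≠ 0 := (μ.mem_support_iff t').1 ht'
    exact (htmin t' (h2 t' h0)).not_gt (hnz.rank_lt ⟨α, μ, hμ, h0⟩)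

/-- A fixpoint that is finite where the value is finite is bounded by the value: the function
`potential + value` is a strict Lyapunov function for a greedy selector, so that the error
contracts. -/
lemma le_value_of_fixed [Finite A] (hstates : ∀ s, s ∈ M.PS ∨ s ∈ M.MS) (hnz : M.NonZeno)
    {u : S → ℝ≥0∞} (hu : M.bellmanENN G u = u) (hfin : ∀ s, M.value G s ≠ ⊤ → u s ≠ ⊤) :
    u ≤ M.value G := by
  classical
  obtain ⟨a, ha, hgreedy⟩ := M.exists_greedy G hstates (M.value G)
  rw [M.bellmanENN_value G] at hgreedy
  set V := M.value G
  set h : S → ℝ≥0∞ := fun s => M.potential G s + V s with h_def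
  have hhtop : ∀ s, V s ≠ ⊤ → h s ≠ ⊤ := fun s hs =>
    ENNReal.add_ne_top.2 ⟨M.potential_ne_top G s, hs⟩
  have hlyap : ∀ s ∉ G, M.gap + M.mean h s (a s) ≤ h s := by
    intro s hs
    rw [h_def, mean_add, ← add_assoc]
    calc _ ≤ (M.stageCost s (a s) + M.potential G s) + M.mean V s (a s) := by
          exact add_le_add_left (gap_add_mean_potential_le hnz (ha s) hs) _
      _ = M.potential G s + (M.stageCost s (a s) + M.mean V s (a s)) := by ring
      _ = _ := by rw [hgreedy s hs]
  -- A finite upper bound for `h` on the states of finite value.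
  set H : ℝ≥0∞ := ∑ s, if V s = ⊤ then 0 else h s
  have hH : ∀ s, V s ≠ ⊤ → h s ≤ H := fun s hs => by
    have := Finset.single_le_sum (f := fun s => if V s = ⊤ then 0 else h s)
      (fun _ _ => zero_le) (Finset.mem_univ s)
    simpa [hs] using this
  have hHtop : H ≠ ⊤ := ENNReal.sum_ne_top.2 fun s _ => by
    split_ifs with hs
    · simp
    · exact hhtop s hs
  -- From `gap + mean h ≤ h ≤ H` follows `mean h * (H + gap) ≤ H * h`, a contraction by this factor.
  set ρ := H / (H + M.gap)
  have hgap0 := M.gap_ne_zero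
  have hden0 : H + M.gap ≠ 0 := by simp [hgap0]
  have hdentop : H + M.gap ≠ ⊤ := ENNReal.add_ne_top.2 ⟨hHtop, M.gap_ne_top⟩
  have hρ : ρ < 1 := by
    rw [ENNReal.div_lt_iff (Or.inl hden0) (Or.inl hdentop), one_mul]
    exact ENNReal.lt_add_right hHtop hgap0
  have hcontr : ∀ s ∉ G, V s ≠ ⊤ → M.mean h s (a s) ≤ ρ * h s := by
    intro s hs hVs
    have hl := hlyap s hs
    have h1 : M.mean h s (a s) * (H + M.gap) ≤ H * h s := by
      calc _ = M.mean h s (a s) * H + M.mean h s (a s) * M.gap := mul_add _ _ _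
        _ ≤ M.mean h s (a s) * H + H * M.gap := by
          gcongr
          exact le_add_self.trans (hl.trans (hH s hVs))
        _ = H * (M.gap + M.mean h s (a s)) := by ring
        _ ≤ H * h s := by gcongr
    rw [show ρ * h s = H * h s / (H + M.gap) by
      simp only [ρ, div_eq_mul_inv]; ring]
    exact (ENNReal.le_div_iff_mul_le (Or.inl hden0) (Or.inl hdentop)).2 h1
  -- An error of at most `θ * h` shrinks by `ρ` when `u` is bounded through the label that is greedy
  -- for `V`, which need not be greedy for `u`.
  have hstep : ∀ θ : ℝ≥0∞, (∀ s, u s ≤ V s + θ * h s) → ∀ s, u s ≤ V s + θ * ρ * h s := by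
    intro θ hθ s
    by_cases hVs : V s = ⊤
    · simp [hVs]
    by_cases hs : s ∈ G
    · rw [← hu, M.bellmanENN_goal G hs]; exact zero_le
    calc u s = M.bellmanENN G u s := by rw [hu]
      _ ≤ M.stageCost s (a s) + M.mean u s (a s) := M.bellmanENN_le G hs (ha s) u
      _ ≤ M.stageCost s (a s) + M.mean (fun s => V s + θ * h s) s (a s) := by
        gcongr; exact M.mean_mono hθ s (a s)
      _ = (M.stageCost s (a s) + M.mean V s (a s)) + θ * M.mean h s (a s) := by
        rw [mean_add, mean_const_mul, add_assoc]
      _ ≤ V s + θ * (ρ * h s) := by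
        rw [hgreedy s hs]; gcongr; exact hcontr s hs hVs
      _ = _ := by rw [mul_assoc]
  -- An initial error bound exists because `h ≥ gap` outside the goal, so `u / gap * h ≥ u`. Here
  -- finiteness of `u` where `V` is finite is essential.
  obtain ⟨θ, hθtop, hθ⟩ : ∃ θ : ℝ≥0∞, θ ≠ ⊤ ∧ ∀ s, u s ≤ V s + θ * h s := by
    refine ⟨∑ s, if V s = ⊤ then 0 else u s / M.gap, ENNReal.sum_ne_top.2 fun s _ => ?_,
      fun s => ?_⟩
    · split_ifs with hs
      · simp
      · exact ENNReal.div_ne_top (hfin s hs) hgap0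
    · by_cases hVs : V s = ⊤
      · simp [hVs]
      by_cases hs : s ∈ G
      · rw [← hu, M.bellmanENN_goal G hs]; exact zero_le
      refine le_trans ?_ le_add_self
      have h1 := Finset.single_le_sum (f := fun s => if V s = ⊤ then 0 else u s / M.gap)
        (fun _ _ => zero_le) (Finset.mem_univ s)
      simp only [hVs, if_false] at h1
      calc u s = u s / M.gap * M.gap := (ENNReal.div_mul_cancel hgap0 M.gap_ne_top).symm
        _ ≤ _ := mul_le_mul' h1 (le_self_add.trans (hlyap s hs))
  have hiter : ∀ n : ℕ, ∀ s, u s ≤ V s + θ * ρ ^ n * h s := by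
    intro n
    induction n with
    | zero => simpa using hθ
    | succ n ih => simpa only [pow_succ, mul_assoc] using hstep _ ih
  intro s
  by_cases hVs : V s = ⊤
  · simp [hVs]
  have hlim : Filter.Tendsto (fun n : ℕ => V s + θ * ρ ^ n * h s) Filter.atTop
      (nhds (V s + θ * 0 * h s)) :=
    (ENNReal.Tendsto.mul_const (ENNReal.Tendsto.const_mul
      (ENNReal.tendsto_pow_atTop_nhds_zero_of_lt_one hρ) (Or.inr hθtop))
      (Or.inr (hhtop s hVs))).const_add _
  have := ge_of_tendsto' hlim fun n => hiter n s
  simpa using this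

end MarkovAutomaton

end

/-! ### Proof of the theorem -/

open MarkovAutomaton in
theorem theorem2 {S A : Type*} [Fintype S] [MeasurableSpace S] [DiscreteMeasurableSpace S]
    [Fintype A] (M : MarkovAutomaton S A) (G : Set S)
    (hstates : ∀ s, s ∈ M.PS ∨ s ∈ M.MS) (hnonZeno : M.NonZeno) (hG : M.Absorbing G) :
    (∀ s, M.minExpectedTime G s = (M.sspEt G).minExpectedCost s) ∧
    (∃ D : M.controlled.Policy, M.IsStationaryDeterministic D ∧
      ∀ s, M.expectedTime D G s = M.minExpectedTime G s) ∧
    M.bellman G (fun s => (M.minExpectedTime G s : EReal)) =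
      (fun s => (M.minExpectedTime G s : EReal)) ∧
    ∀ v : S → EReal, M.bellman G v = v → (∀ s, v s ≠ ⊥) →
      (∀ s, M.minExpectedTime G s ≠ ⊤ → v s ≠ ⊤) →
      v = fun s => (M.minExpectedTime G s : EReal) := by
  obtain ⟨a, ha, hgreedy⟩ := M.exists_greedy G hstates (M.value G)
  rw [M.bellmanENN_value G] at hgreedy
  let D : M.controlled.Policy := (M.timeModel G).stationaryPolicy a fun x => ha _
  have hD : ∀ s, M.expectedTime D G s = M.value G s := fun s => by
    simp only [expectedTime, ← M.totalCost_timeModel G]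
    exact lintegral_totalCost_greedy (M.timeModel G) rfl rfl rfl (fun _ _ => Iff.rfl) hnonZeno ha
      hgreedy _
  have htime : ∀ s, M.minExpectedTime G s = M.value G s := fun s => by
    refine le_antisymm ((iInf_le _ D).trans (hD s).le) (le_iInf fun D' => ?_)
    simp only [expectedTime, ← M.totalCost_timeModel G]
    exact value_le_lintegral_totalCost (M.timeModel G) rfl rfl rfl (fun _ _ => id) D' _
  have hcost : ∀ s, (M.sspEt G).minExpectedCost s = M.value G s := fun s => by
    simp only [SSP.minExpectedCost, ← M.totalCost_sspModel G]
    refine le_antisymm ((iInf_le _ ((M.sspModel G).stationaryPolicy a fun x =>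
      (M.enabled_sspEt_iff G x _).2 (ha _))).trans ?_) (le_iInf fun D' => ?_)
    · exact (lintegral_totalCost_greedy (M.sspModel G) rfl rfl rfl (M.enabled_sspEt_iff G)
        hnonZeno ha hgreedy _).le
    · exact value_le_lintegral_totalCost (M.sspModel G) rfl rfl rfl
        (fun x σ => (M.enabled_sspEt_iff G x σ).1) D' _
  simp only [htime, hcost]
  refine ⟨fun _ => trivial, ⟨D, ?_, hD⟩, ?_, fun v hv hbot hfin => ?_⟩
  -- Maximal progress: `⊥` is not enabled in a probabilistic state, so the selector picks an action
  -- there.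
  · have hsome : ∀ s : M.PS, ∃ α, a s = some α := fun s => by
      cases h : a s with
      | none =>
        have h1 := ha s
        rw [h] at h1
        exact absurd s.2 h1.1
      | some α => exact ⟨α, rfl⟩
    choose d hd using hsome
    exact ⟨d, fun n h hs => congrArg PMF.pure (hd ⟨h.last.2.2, hs⟩)⟩
  · ext s
    rw [bellman_coe, M.bellmanENN_value G]
  · have hnn := nonneg_of_fixed hstates hnonZeno hv hbot
    obtain ⟨u, rfl⟩ : ∃ u : S → ℝ≥0∞, v = fun s => (u s : EReal) :=
      ⟨fun s => (v s).toENNReal, funext fun s => (EReal.coe_toENNReal (hnn s)).symm⟩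
    have hu : M.bellmanENN G u = u := funext fun s => by
      have := congrFun hv s
      rwa [bellman_coe, EReal.coe_ennreal_eq_coe_ennreal_iff] at this
    have huV : u = M.value G := le_antisymm
      (le_value_of_fixed hstates hnonZeno hu fun s hs => by simpa using hfin s hs)
      (M.value_le_of_fixed G hu)
    rw [huV]
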